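/- By an ordered semigroup we mean a semigroup $(S,\cdot)$ equipped with a partial order $\le$ that is stable, i.e. $s\le t$ implies $as\le at$ and $sa\le ta$ for all $a,s,t\in S$. A pseudovariety of ordered semigroups is a class of finite ordered semigroups closed under homomorphic images (images under isotone semigroup homomorphisms), ordered subsemigroups (with the induced order) and finite products. For a pseudovariety $\mathsf V$ of ordered semigroups, let $\mathsf V^d$ be the pseudovariety of all $(S,\cdot,\le)$ such that $(S,\cdot,\ge)\in\mathsf V$; call $\mathsf V$ selfdual if $\mathsf V=\mathsf V^d$. The join $\mathsf V\vee\mathsf W$ is the least pseudovariety of ordered semigroups containing $\mathsf V$ and $\mathsf W$. The selfdual closure of $\mathsf V$ is $\mathsf V\vee\mathsf V^d$, the least selfdual pseudovariety containing $\mathsf V$. Let $\mathsf{Sl}$ be the pseudovariety of all finite semilattices (commutative idempotent semigroups) with all possible stable partial orders. **Proposition.** Let $\mathsf V$ be a pseudovariety of ordered completely regular semigroups, i.e. a pseudovariety of ordered semigroups all of whose members are completely regular (unions of groups). Then the selfdual closure of $\mathsf V$ satisfies $$\mathsf V\vee\mathsf V^d=\mathsf V\vee\mathsf V',$$ where $\mathsf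 V'=(\mathsf V\cap\mathsf{Sl})\vee(\mathsf V\cap\mathsf{Sl})^d$ is the selfdual closure of $\mathsf V\cap\mathsf{Sl}$. -/

import Mathlib

universe u

/-- A finite ordered semigroup: a finite (nonempty) semigroup with a stable partial order,
i.e. a partial order compatible with multiplication on both sides. -/
structure FinOrdSemigroup where
  carrier : Type u
  [semigroup : Semigroup carrier]
  [order : PartialOrder carrier]
  [mulLeftMono : MulLeftMono carrier]
  [mulRightMono : MulRightMono carrier]
  [finite : Finite carrier]
  [nonempty : Nonempty carrier]

namespace FinOrdSemigroup

instance : CoeSort FinOrdSemigroup.{u} (Type u) := ⟨carrier⟩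

attribute [instance] semigroup order mulLeftMono mulRightMono finite nonempty

/-- The dually ordered semigroup `(S, ·, ≥)` of `(S, ·, ≤)`. -/
def dual (S : FinOrdSemigroup.{u}) : FinOrdSemigroup.{u} where
  carrier := (S : Type u)ᵒᵈ

/-- The product of a family of ordered semigroups indexed by a finite type, with the
componentwise operation and order. -/
def pi {ι : Type} [Finite ι] (S : ι → FinOrdSemigroup.{u}) : FinOrdSemigroup.{u} where
  carrier := ∀ i, S i
  mulLeftMono := ⟨fun a x y (h : ∀ i, x i ≤ y i) i => mul_le_mul_right (h i) (a i)⟩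
  mulRightMono := ⟨fun a x y (h : ∀ i, x i ≤ y i) i => mul_le_mul_left (h i) (a i)⟩

/-- `T` is a homomorphic image of `S`: there is a surjective isotone semigroup homomorphism
from `S` onto `T`. -/
def IsImage (T S : FinOrdSemigroup.{u}) : Prop :=
  ∃ f : S →ₙ* T, Monotone f ∧ Function.Surjective f

/-- `T` is (isomorphic to) an ordered subsemigroup of `S`: it embeds in `S` as a semigroup,
and its order is the one induced from `S`. -/
def IsSub (T S : FinOrdSemigroup.{u}) : Prop :=
  ∃ f : T →ₙ* S, Function.Injective f ∧ ∀ x y, f x ≤ f y ↔ x ≤ y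

/-- Complete regularity: there is a unary operation of inversion satisfying
`x x⁻¹ x = x`, `(x⁻¹)⁻¹ = x` and `x x⁻¹ = x⁻¹ x`. -/
def IsCompletelyRegular (S : FinOrdSemigroup.{u}) : Prop :=
  ∃ inv : S → S, ∀ x, x * inv x * x = x ∧ inv (inv x) = x ∧ x * inv x = inv x * x

/-- A semilattice: a commutative idempotent semigroup (with any stable partial order). -/
def IsSemilattice (S : FinOrdSemigroup.{u}) : Prop :=
  (∀ x : S, x * x = x) ∧ ∀ x y : S, x * y = y * x

end FinOrdSemigroup

open FinOrdSemigroup in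
/-- A pseudovariety of ordered semigroups: a class of finite ordered semigroups closed under
homomorphic images, ordered subsemigroups and finite products. -/
@[ext]
structure Pseudovariety where
  carrier : Set FinOrdSemigroup.{u}
  image_mem : ∀ {S T : FinOrdSemigroup.{u}}, S ∈ carrier → IsImage T S → T ∈ carrier
  sub_mem : ∀ {S T : FinOrdSemigroup.{u}}, S ∈ carrier → IsSub T S → T ∈ carrier
  pi_mem : ∀ {ι : Type} [Finite ι] (S : ι → FinOrdSemigroup.{u}),
    (∀ i, S i ∈ carrier) → pi S ∈ carrier

namespace Pseudovariety

open FinOrdSemigroup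

instance : Membership FinOrdSemigroup.{u} Pseudovariety.{u} := ⟨fun V S => S ∈ V.carrier⟩

/-- Pseudovarieties are ordered by inclusion. -/
instance : PartialOrder Pseudovariety.{u} :=
  PartialOrder.lift carrier fun _ _ => Pseudovariety.ext

/-- The intersection of two pseudovarieties. -/
instance : Min Pseudovariety.{u} where
  min V W :=
    { carrier := V.carrier ∩ W.carrier
      image_mem := fun h i => ⟨V.image_mem h.1 i, W.image_mem h.2 i⟩
      sub_mem := fun h i => ⟨V.sub_mem h.1 i, W.sub_mem h.2 i⟩
      pi_mem := fun S h => ⟨V.pi_mem S fun i => (h i).1, W.pi_mem S fun i => (h i).2⟩ }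

/-- The intersection of a family of pseudovarieties. -/
instance : InfSet Pseudovariety.{u} where
  sInf K :=
    { carrier := {S | ∀ V ∈ K, S ∈ V}
      image_mem := fun h i V hV => V.image_mem (h V hV) i
      sub_mem := fun h i V hV => V.sub_mem (h V hV) i
      pi_mem := fun S h V hV => V.pi_mem S fun i => h i V hV }

/-- The lattice of pseudovarieties under inclusion: the meet `⊓` is the intersection, and the
join `V ⊔ W` is the least pseudovariety containing `V` and `W`. -/
instance : CompleteLattice Pseudovariety.{u} :=
  { completeLatticeOfInf Pseudovariety.{u} fun _ =>
      ⟨fun _ hV _ hS => hS _ hV, fun _ hW _ hS V hV => hW hV hS⟩ with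
    inf := min
    inf_le_left := fun _ _ _ h => h.1
    inf_le_right := fun _ _ _ h => h.2
    le_inf := fun _ _ _ h k _ hS => ⟨h hS, k hS⟩ }

/-- The pseudovariety `Vᵈ` of all finite ordered semigroups `(S, ·, ≤)` such that
`(S, ·, ≥)` belongs to `V`. -/
def dual (V : Pseudovariety.{u}) : Pseudovariety.{u} where
  carrier := {S | S.dual ∈ V}
  image_mem := fun {S T} h ⟨f, hm, hs⟩ => V.image_mem (S := S.dual) (T := T.dual) h
    ⟨⟨fun x => OrderDual.toDual (f (OrderDual.ofDual x)),
        fun x y => congrArg OrderDual.toDual (map_mul f (OrderDual.ofDual x) (OrderDual.ofDual y))⟩,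
      fun _ _ hxy => hm hxy, fun y => (hs (OrderDual.ofDual y)).imp fun _ hx =>
        congrArg OrderDual.toDual hx⟩
  sub_mem := fun {S T} h ⟨f, hi, ho⟩ => V.sub_mem (S := S.dual) (T := T.dual) h
    ⟨⟨fun x => OrderDual.toDual (f (OrderDual.ofDual x)),
        fun x y => congrArg OrderDual.toDual (map_mul f (OrderDual.ofDual x) (OrderDual.ofDual y))⟩,
      fun _ _ hxy => hi hxy, fun x y => ho (OrderDual.ofDual y) (OrderDual.ofDual x)⟩
  pi_mem := fun S h => V.image_mem (T := (pi S).dual) (V.pi_mem (fun i => (S i).dual) h)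
    ⟨⟨fun x => OrderDual.toDual fun i => OrderDual.ofDual (x i), fun _ _ => rfl⟩,
      fun _ _ hxy => hxy, fun y => ⟨fun i => OrderDual.toDual (OrderDual.ofDual y i), rfl⟩⟩

/-- `V` is selfdual if `V = Vᵈ`. -/
def IsSelfdual (V : Pseudovariety.{u}) : Prop := V = V.dual

/-- The pseudovariety of all finite ordered semilattices. -/
def semilattices : Pseudovariety.{u} where
  carrier := {S | S.IsSemilattice}
  image_mem := by
    rintro S T ⟨h₁, h₂⟩ ⟨f, -, hs⟩
    refine ⟨fun x => ?_, fun x y => ?_⟩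
    · obtain ⟨x, rfl⟩ := hs x
      rw [← map_mul, h₁]
    · obtain ⟨x, rfl⟩ := hs x
      obtain ⟨y, rfl⟩ := hs y
      rw [← map_mul, h₂, map_mul]
  sub_mem := by
    rintro S T ⟨h₁, h₂⟩ ⟨f, hi, -⟩
    exact ⟨fun x => hi (by rw [map_mul, h₁]), fun x y => hi (by rw [map_mul, map_mul, h₂])⟩
  pi_mem := fun S h =>
    ⟨fun x => funext fun i => (h i).1 (x i), fun x y => funext fun i => (h i).2 (x i) (y i)⟩

/-- The selfdual closure `V ∨ Vᵈ` of `V`. -/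
def selfdualClosure (V : Pseudovariety.{u}) : Pseudovariety.{u} := V ⊔ V.dual

theorem dual_dual (V : Pseudovariety.{u}) : V.dual.dual = V := rfl

theorem dual_mono {V W : Pseudovariety.{u}} (h : V ≤ W) : V.dual ≤ W.dual :=
  fun S hS => h (a := S.dual) hS

/-- The selfdual closure of `V` is the least selfdual pseudovariety containing `V`. -/
theorem isLeast_selfdualClosure (V : Pseudovariety.{u}) :
    IsLeast {W : Pseudovariety.{u} | W.IsSelfdual ∧ V ≤ W} V.selfdualClosure := by
  have key : V.selfdualClosure ≤ V.selfdualClosure.dual :=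
    sup_le (dual_mono (le_sup_right : V.dual ≤ V ⊔ V.dual)) (dual_mono le_sup_left)
  refine ⟨⟨le_antisymm key (dual_mono key), le_sup_left⟩, ?_⟩
  rintro W ⟨hW, hVW⟩
  refine sup_le hVW ?_
  rw [hW]
  exact dual_mono hVW

end Pseudovariety

/-! The proof rests on a rigidity fact, `rel_symm`. Suppose a completely regular ordered semigroup
with x ^ (K + 2) = x satisfies u ≤ v, where u and v have the same letters (the same content). Then
it also satisfies v ≤ u.

Rigidity is proved by induction on the number of letters. A group of finite exponent has no
nontrivial stable order, since g ≤ e gives e = g ^ (K + 1) ≤ g. It therefore suffices to place u in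
the H-class of v; reversal of words reduces this to one side, where v ≤ u * t is enough
(`exists_le_mul`). To obtain it, u and v are cut before new letters x and y, at prefixes p and q of
equal, smaller content. Substituting long words for x and y turns u ≤ v into a comparison of p and q
acting on the left of R-classes. This comparison is again a word preorder (`derived`), so the
induction hypothesis reverses it.

Now let S belong to V. If some member of V has idempotents e ≠ f with ef = fe = f, then {e, f} is a
semilattice in V, and equalities valid in it preserve content. Otherwise S satisfies (aba) ^ (K + 1)
a = a, so both sides of any valid inequality between nonempty words can be rewritten with equal
content. In either case rigidity reverses the relevant inequalities of S, and `dual_mem_of_rel_symm`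
turns this into membership of the dual of S. -/

namespace CompletelyRegular

/-! ### Ordered monoids with x ^ (K + 2) = x. -/

section Monoid

variable {M : Type*} [Monoid M] {K : ℕ}

theorem pow_mul_self (hM : ∀ x : M, x ^ (K + 2) = x) (x : M) : x ^ (K + 1) * x = x := by
  rw [← pow_succ, hM]

theorem mul_pow_self (hM : ∀ x : M, x ^ (K + 2) = x) (x : M) : x * x ^ (K + 1) = x := by
  rw [← pow_succ', hM]

theorem pow_mul_pow (hM : ∀ x : M, x ^ (K + 2) = x) (x : M) :
    x ^ (K + 1) * x ^ (K + 1) = x ^ (K + 1) := by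
  calc x ^ (K + 1) * x ^ (K + 1) = x ^ (K + 1) * x * x ^ K := by rw [mul_assoc, ← pow_succ']
    _ = x ^ (K + 1) := by rw [pow_mul_self hM, ← pow_succ']

/-- In a completely regular monoid, the element represented by a word `r` absorbs on the right
every word over the letters of `r`, up to a further factor over the letters of `r`. -/
theorem exists_mul_mul_eq {α : Type*} [DecidableEq α] (hM : ∀ x : M, x ^ (K + 2) = x)
    (π : FreeMonoid α →* M) (s : FreeMonoid α) : ∀ r : FreeMonoid α, s.symbols ⊆ r.symbols →
    ∃ t : FreeMonoid α, t.symbols ⊆ r.symbols ∧ π r * π s * π t = π r := by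
  have letter : ∀ (r : FreeMonoid α) (a : α), a ∈ r.symbols →
      ∃ t : FreeMonoid α, t.symbols ⊆ r.symbols ∧ π r * π (.of a) * π t = π r := by
    intro r a ha
    obtain ⟨x, b, rfl⟩ : ∃ x b : FreeMonoid α, r = x * .of a * b := by
      obtain ⟨l₁, l₂, h⟩ := List.append_of_mem (FreeMonoid.mem_symbols.1 ha)
      refine ⟨FreeMonoid.ofList l₁, FreeMonoid.ofList l₂, ?_⟩
      rw [mul_assoc]
      exact h
    -- For r = x a b, the word r a t becomes x (ab) ^ (K + 2), which has the value of x a b.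
    refine ⟨b * (.of a * b) ^ K, ?_, ?_⟩
    · have : ∀ k, ((FreeMonoid.of a * b) ^ k).symbols ⊆ {a} ∪ b.symbols := by
        intro k
        induction k with
        | zero => simp
        | succ k ih =>
          rw [pow_succ, FreeMonoid.symbols_mul, FreeMonoid.symbols_mul, FreeMonoid.symbols_of]
          exact Finset.union_subset ih subset_rfl
      have := this K
      simp only [FreeMonoid.symbols_mul, FreeMonoid.symbols_of] at *
      grind
    · have h := hM (π (.of a) * π b)
      rw [pow_succ', pow_succ'] at h
      simp only [map_mul, map_pow, mul_assoc] at h ⊢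
      rw [h]
  induction s using FreeMonoid.inductionOn' with
  | one => exact fun r _ => ⟨1, by simp, by simp⟩
  | of_mul a s ih =>
    intro r hs
    rw [FreeMonoid.symbols_mul, FreeMonoid.symbols_of] at hs
    obtain ⟨t₁, h₁, e₁⟩ := letter r a (hs (by simp))
    have hra : (r * .of a).symbols = r.symbols := by
      rw [FreeMonoid.symbols_mul, FreeMonoid.symbols_of]
      grind
    obtain ⟨t₂, h₂, e₂⟩ := ih (r * .of a) (by grind)
    refine ⟨t₂ * t₁, by rw [FreeMonoid.symbols_mul]; grind, ?_⟩
    simp only [map_mul, ← mul_assoc] at e₂ ⊢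
    rw [e₂, e₁]

/-- With e = u ^ (K + 1) and g = e h e, the hypothesis gives g t = e. So g is R-equivalent to e
inside the local monoid at e, hence lies in the group of units there. -/
theorem pow_conj_pow (hM : ∀ x : M, x ^ (K + 2) = x) {u h t : M}
    (ht : u * h * u ^ (K + 1) * t = u) :
    (u ^ (K + 1) * h * u ^ (K + 1)) ^ (K + 1) = u ^ (K + 1) := by
  set e := u ^ (K + 1) with he
  have hee : e * e = e := pow_mul_pow hM u
  have hK : u ^ K * u = e := (pow_succ ..).symm
  have hgt : e * h * e * t = e := by
    calc e * h * e * t = u ^ K * (u * h * e * t) := by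
            simp only [← mul_assoc]
            rw [hK]
      _ = e := by rw [ht, hK]
  set g := e * h * e with hg
  have hge : g * e = g := by rw [hg, mul_assoc, hee]
  calc g ^ (K + 1) = g ^ (K + 1) * e := by rw [pow_succ, mul_assoc, hge]
    _ = g ^ (K + 1) * (g * t) := by rw [hgt]
    _ = g * t := by rw [← mul_assoc, pow_mul_self hM]
    _ = e := hgt

variable [PartialOrder M] [MulLeftMono M] [MulRightMono M]

/-- The element v a e is squeezed between u and u g, where g = e b a e. Iterating u g ≤ u g ^ (k +
1) reaches g ^ (K + 1) = e, and u e = u closes the squeeze. -/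
theorem eq_mul_of_le_mul (hM : ∀ x : M, x ^ (K + 2) = x) {u v a b t : M}
    (hu : u ≤ v * a) (hv : v ≤ u * b) (ht : u * (b * a) * u ^ (K + 1) * t = u) :
    u = v * (a * u ^ (K + 1)) := by
  have hg := pow_conj_pow hM ht
  set e := u ^ (K + 1) with he
  set g := e * (b * a) * e with hgdef
  have hue : u * e = u := mul_pow_self hM u
  have h1 : u ≤ v * (a * e) := by
    calc u = u * e := hue.symm
      _ ≤ v * a * e := by gcongr
      _ = v * (a * e) := mul_assoc ..
  have h2 : v * (a * e) ≤ u * g := by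
    calc v * (a * e) ≤ u * b * (a * e) := by gcongr
      _ = u * e * b * (a * e) := by rw [hue]
      _ = u * g := by simp only [hgdef, mul_assoc]
  have h3 : ∀ k, u * g ≤ u * g ^ (k + 1) := by
    intro k
    induction k with
    | zero => simp
    | succ k ih =>
      calc u * g ≤ u * g ^ (k + 1) := ih
        _ ≤ (u * g) * g ^ (k + 1) := by gcongr; exact h1.trans h2
        _ = u * g ^ (k + 1 + 1) := by rw [mul_assoc, ← pow_succ']
  refine le_antisymm h1 (h2.trans ((h3 K).trans ?_))
  rw [hg, hue]

/-- The factorizations put g = e v ^ K u e in the group of e = v ^ (K + 1), and u ≤ v gives g ≤ e.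
Powers of g descend, so e = g ^ (K + 1) ≤ g; multiplying by v yields v ≤ v g = u. -/
theorem le_of_mul_eq (hM : ∀ x : M, x ^ (K + 2) = x) {u v a b t : M}
    (huv : u ≤ v) (ha : u = v * a) (hb : u = b * v) (ht : u * t = v) : v ≤ u := by
  have hl : v ^ (K + 1) * u = u := by rw [ha, ← mul_assoc, pow_mul_self hM]
  have hr : u * v ^ (K + 1) = u := by rw [hb, mul_assoc, mul_pow_self hM]
  have hg : (v ^ (K + 1) * (v ^ K * u) * v ^ (K + 1)) ^ (K + 1) = v ^ (K + 1) := by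
    refine pow_conj_pow hM (t := t) ?_
    rw [← mul_assoc v, ← pow_succ', hl, hr, ht]
  set e := v ^ (K + 1) with he
  have hee : e * e = e := pow_mul_pow hM v
  set g := e * (v ^ K * u) * e with hgdef
  have hge : g ≤ e := by
    calc g ≤ e * (v ^ K * v) * e := by rw [hgdef]; gcongr
      _ = e := by rw [← pow_succ, hee, hee]
  have hk : ∀ k, g ^ (k + 1) ≤ g := by
    intro k
    induction k with
    | zero => simp
    | succ k ih =>
      calc g ^ (k + 1 + 1) = g ^ (k + 1) * g := pow_succ ..
        _ ≤ g * e := by gcongr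
        _ = g := by rw [hgdef, mul_assoc _ e e, hee]
  calc v = v * e := (mul_pow_self hM v).symm
    _ ≤ v * g := by gcongr; exact hg.symm.le.trans (hk K)
    _ = v * e * v ^ K * (u * e) := by simp only [hgdef, mul_assoc]
    _ = u := by rw [hr, mul_pow_self hM, ← pow_succ', hl]

end Monoid

/-- A stable preorder on words which is compatible with nonerasing substitutions and under
which every word `w` is equivalent to `w ^ (K + 2)`. -/
structure WordPreorder (α : Type*) (K : ℕ) where
  rel : FreeMonoid α → FreeMonoid α → Prop
  refl : ∀ p, rel p p
  trans : ∀ {p q r}, rel p q → rel q r → rel p r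
  mul_left : ∀ {p q} (r), rel p q → rel (r * p) (r * q)
  mul_right : ∀ {p q} (r), rel p q → rel (p * r) (q * r)
  subst : ∀ {p q} (φ : FreeMonoid α →* FreeMonoid α), (∀ a, φ (.of a) ≠ 1) →
    rel p q → rel (φ p) (φ q)
  le_pow : ∀ p, rel p (p ^ (K + 2))
  pow_le : ∀ p, rel (p ^ (K + 2)) p

/-! ### Word preorders, the ordered monoids they present, and reversal. -/

namespace WordPreorder

variable {α : Type*} {K : ℕ}

/-- The congruence associated with a word preorder. -/
def con (W : WordPreorder α K) : Con (FreeMonoid α) where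
  r p q := W.rel p q ∧ W.rel q p
  iseqv := ⟨fun p => ⟨W.refl p, W.refl p⟩, And.symm,
    fun h k => ⟨W.trans h.1 k.1, W.trans k.2 h.2⟩⟩
  mul' h k := ⟨W.trans (W.mul_right _ h.1) (W.mul_left _ k.1),
    W.trans (W.mul_right _ h.2) (W.mul_left _ k.2)⟩

/-- The ordered monoid presented by a word preorder. -/
abbrev Quot (W : WordPreorder α K) : Type _ := W.con.Quotient

/-- The quotient morphism. -/
abbrev toQuot (W : WordPreorder α K) : FreeMonoid α →* W.Quot := W.con.mk'

instance (W : WordPreorder α K) : PartialOrder W.Quot where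
  le := Quotient.lift₂ W.rel fun _ _ _ _ h k => propext
    ⟨fun l => W.trans h.2 (W.trans l k.1), fun l => W.trans h.1 (W.trans l k.2)⟩
  le_refl := by rintro ⟨p⟩; exact W.refl p
  le_trans := by rintro ⟨p⟩ ⟨q⟩ ⟨r⟩; exact W.trans
  le_antisymm := by rintro ⟨p⟩ ⟨q⟩ h k; exact Quotient.sound ⟨h, k⟩

theorem toQuot_le_toQuot (W : WordPreorder α K) {p q : FreeMonoid α} : W.toQuot p ≤ W.toQuot q ↔ W.rel p q :=
  Iff.rfl

instance (W : WordPreorder α K) : MulLeftMono W.Quot :=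
  ⟨by rintro ⟨r⟩ ⟨p⟩ ⟨q⟩ h; exact W.mul_left r h⟩

instance (W : WordPreorder α K) : MulRightMono W.Quot :=
  ⟨by rintro ⟨r⟩ ⟨p⟩ ⟨q⟩ h; exact W.mul_right r h⟩

theorem quot_pow (W : WordPreorder α K) (x : W.Quot) : x ^ (K + 2) = x := by
  obtain ⟨p, rfl⟩ := W.con.mk'_surjective x
  rw [← map_pow]
  exact le_antisymm (W.pow_le p) (W.le_pow p)

/-- The left-right reversal of a word preorder. -/
def reverse (W : WordPreorder α K) : WordPreorder α K where
  rel p q := W.rel p.reverse q.reverse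
  refl p := W.refl _
  trans h k := W.trans h k
  mul_left r h := by
    simp only [FreeMonoid.reverse_mul]
    exact W.mul_right _ h
  mul_right r h := by
    simp only [FreeMonoid.reverse_mul]
    exact W.mul_left _ h
  subst {p q} φ hφ h := by
    have key : ∀ w : FreeMonoid α, (φ w).reverse =
        FreeMonoid.lift (fun a => (φ (.of a)).reverse) w.reverse := by
      intro w
      induction w using FreeMonoid.inductionOn' with
      | one => rw [map_one]; exact (map_one _).symm
      | of_mul a w ih =>
        rw [map_mul, FreeMonoid.reverse_mul, FreeMonoid.reverse_mul, map_mul, ih,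
          FreeMonoid.reverse_of, FreeMonoid.lift_eval_of]
    rw [key, key]
    refine W.subst _ (fun a ha => hφ a ?_) h
    rw [FreeMonoid.lift_eval_of] at ha
    exact List.reverse_eq_nil_iff.1 ha
  le_pow p := by rw [reverse_pow]; exact W.le_pow _
  pow_le p := by rw [reverse_pow]; exact W.pow_le _
where
  reverse_pow (p : FreeMonoid α) (k : ℕ) : (p ^ k).reverse = p.reverse ^ k := by
    induction k with
    | zero => rfl
    | succ k ih => rw [pow_succ, pow_succ', FreeMonoid.reverse_mul, ih]

end WordPreorder

end CompletelyRegular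

namespace CompletelyRegular

/-! ### Contents of words and their prefixes. -/

section Words

variable {α : Type*} [DecidableEq α]

theorem symbols_hom_subset {φ : FreeMonoid α →* FreeMonoid α} {w : FreeMonoid α} {B : Finset α}
    (h : ∀ a ∈ w.symbols, (φ (.of a)).symbols ⊆ B) : (φ w).symbols ⊆ B := by
  induction w using FreeMonoid.inductionOn' with
  | one => simp
  | of_mul a w ih =>
    simp only [map_mul, FreeMonoid.symbols_mul, FreeMonoid.symbols_of] at h ⊢
    exact Finset.union_subset (h a (by simp)) (ih fun b hb => h b (by simp [hb]))

theorem subset_symbols_hom (φ : FreeMonoid α →* FreeMonoid α) {w : FreeMonoid α} {a : α}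
    (h : a ∈ w.symbols) : (φ (.of a)).symbols ⊆ (φ w).symbols := by
  induction w using FreeMonoid.inductionOn' with
  | one => simp at h
  | of_mul b w ih =>
    simp only [map_mul, FreeMonoid.symbols_mul, FreeMonoid.symbols_of, Finset.mem_union,
      Finset.mem_singleton] at h ⊢
    rcases h with rfl | h
    · exact Finset.subset_union_left
    · exact (ih h).trans Finset.subset_union_right

theorem hom_congr {φ ψ : FreeMonoid α →* FreeMonoid α} {w : FreeMonoid α}
    (h : ∀ a ∈ w.symbols, φ (.of a) = ψ (.of a)) : φ w = ψ w := by
  induction w using FreeMonoid.inductionOn' with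
  | one => rw [map_one, map_one]
  | of_mul a w ih =>
    simp only [FreeMonoid.symbols_mul, FreeMonoid.symbols_of] at h
    rw [map_mul, map_mul, h a (by simp), ih fun b hb => h b (by simp [hb])]

theorem exists_symbols_eq (A : Finset α) : ∃ w : FreeMonoid α, w.symbols = A :=
  ⟨FreeMonoid.ofList A.toList, Finset.toList_toFinset A⟩

theorem symbols_reverse (w : FreeMonoid α) : w.reverse.symbols = w.symbols :=
  List.toFinset_reverse

theorem symbols_pow_subset (w : FreeMonoid α) (k : ℕ) : (w ^ k).symbols ⊆ w.symbols := by
  induction k with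
  | zero => simp
  | succ k ih =>
    rw [pow_succ, FreeMonoid.symbols_mul]
    exact Finset.union_subset ih subset_rfl

theorem symbols_eq_empty {w : FreeMonoid α} : w.symbols = ∅ ↔ w = 1 :=
  List.toFinset_eq_empty_iff w

/-- The first letter of a word lying outside a set of letters. -/
theorem exists_first_notMem {B : Finset α} (w : FreeMonoid α) (h : ¬ w.symbols ⊆ B) :
    ∃ (p : FreeMonoid α) (x : α) (q : FreeMonoid α),
      w = p * .of x * q ∧ p.symbols ⊆ B ∧ x ∉ B := by
  induction w using FreeMonoid.inductionOn' with
  | one => simp at h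
  | of_mul a w ih =>
    by_cases ha : a ∈ B
    · obtain ⟨p, x, q, rfl, hp, hx⟩ := ih fun hw => h (by
        rw [FreeMonoid.symbols_mul, FreeMonoid.symbols_of]
        exact Finset.union_subset (by simpa using ha) hw)
      refine ⟨.of a * p, x, q, by simp only [mul_assoc], ?_, hx⟩
      rw [FreeMonoid.symbols_mul, FreeMonoid.symbols_of]
      exact Finset.union_subset (by simpa using ha) hp
    · exact ⟨1, a, w, by simp, by simp, ha⟩

/-- Two nonempty words with the same letters have prefixes with the same letters which are
followed by new letters, and either these are different or each of them is the last new letter. -/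
theorem exists_common_prefix_symbols (n : ℕ) (A : Finset α) : ∀ p q u v : FreeMonoid α,
    p.symbols = q.symbols → p.symbols ≠ A → (p * u).symbols = A → (q * v).symbols = A →
    (A \ p.symbols).card = n →
    ∃ (p' q' : FreeMonoid α) (x y : α) (u' v' : FreeMonoid α),
      p * u = p' * .of x * u' ∧ q * v = q' * .of y * v' ∧ p'.symbols = q'.symbols ∧
      x ∉ p'.symbols ∧ y ∉ p'.symbols ∧ (x ≠ y ∨ (p' * .of x).symbols = A) := by
  induction n using Nat.strong_induction_on with
  | _ n ih =>
    intro p q u v hpq hA hu hv hn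
    have split : ∀ p w : FreeMonoid α, p.symbols ≠ A → (p * w).symbols = A →
        ∃ p' x w', p * w = p' * .of x * w' ∧ p'.symbols = p.symbols ∧ x ∉ p'.symbols := by
      intro p w hpA hw
      obtain ⟨r, x, w', rfl, hr, hx⟩ := exists_first_notMem (B := p.symbols) w (by
        intro h
        rw [FreeMonoid.symbols_mul, Finset.union_eq_left.2 h] at hw
        exact hpA hw)
      have hpr : (p * r).symbols = p.symbols := by
        rw [FreeMonoid.symbols_mul, Finset.union_eq_left.2 hr]
      exact ⟨p * r, x, w', by simp only [mul_assoc], hpr, by rwa [hpr]⟩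
    obtain ⟨p', x, u', hu', hp', hx⟩ := split p u hA hu
    obtain ⟨q', y, v', hv', hq', hy⟩ := split q v (hpq ▸ hA) hv
    have hpq' : p'.symbols = q'.symbols := by rw [hp', hq', hpq]
    by_cases hxy : x = y
    · subst hxy
      by_cases hxA : (p' * .of x).symbols = A
      · exact ⟨p', q', x, x, u', v', hu', hv', hpq', hx, hpq' ▸ hy, .inr hxA⟩
      · rw [hu', hv']
        refine ih _ ?_ (p' * .of x) (q' * .of x) u' v' ?_ hxA (hu' ▸ hu) (hv' ▸ hv) rfl
        · rw [← hn]
          apply Finset.card_lt_card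
          have hxA' : x ∈ A := by
            rw [← hu, hu', FreeMonoid.symbols_mul, FreeMonoid.symbols_mul, FreeMonoid.symbols_of]
            simp
          rw [FreeMonoid.symbols_mul, FreeMonoid.symbols_of, hp'] at *
          rw [Finset.ssubset_iff]
          refine ⟨x, by simp, ?_⟩
          intro z hz
          simp only [Finset.mem_insert, Finset.mem_sdiff, Finset.mem_union,
            Finset.mem_singleton] at hz ⊢
          grind
        · rw [FreeMonoid.symbols_mul, FreeMonoid.symbols_mul, hpq']
    · exact ⟨p', q', x, y, u', v', hu', hv', hpq', hx, hpq' ▸ hy, .inl hxy⟩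

end Words

/-! ### The derived preorder. -/

namespace WordPreorder

variable {α : Type*} [DecidableEq α] {K : ℕ}

theorem exists_toQuot_mul_eq (W : WordPreorder α K) {r s : FreeMonoid α}
    (h : s.symbols ⊆ r.symbols) : ∃ t : FreeMonoid α, t.symbols ⊆ r.symbols ∧
      W.toQuot r * W.toQuot s * W.toQuot t = W.toQuot r :=
  exists_mul_mul_eq W.quot_pow W.toQuot s r h

theorem exists_rel_mul (W : WordPreorder α K) {r s : FreeMonoid α}
    (h : s.symbols ⊆ r.symbols) : ∃ t : FreeMonoid α, t.symbols ⊆ r.symbols ∧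
      W.rel r (r * s * t) ∧ W.rel (r * s * t) r := by
  obtain ⟨t, ht, e⟩ := W.exists_toQuot_mul_eq h
  exact ⟨t, ht, e.ge, e.le⟩

/-- If `p * r` lies below `q * r` up to a right factor, for all words `r` with sufficiently
many letters, then the same holds after any nonerasing substitution in `p` and `q`. -/
theorem exists_rel_subst [Infinite α] (W : WordPreorder α K) {p q : FreeMonoid α} {A : Finset α}
    (h : ∀ r : FreeMonoid α, A ⊆ r.symbols →
      ∃ t : FreeMonoid α, t.symbols ⊆ r.symbols ∧ W.rel (p * r) (q * r * t))
    (φ : FreeMonoid α →* FreeMonoid α) (hφ : ∀ a, φ (.of a) ≠ 1) {r : FreeMonoid α} (hr : r ≠ 1)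
    (hp : (φ p).symbols ⊆ r.symbols) (hq : (φ q).symbols ⊆ r.symbols) :
    ∃ t : FreeMonoid α, t.symbols ⊆ r.symbols ∧ W.rel (φ p * r) (φ q * r * t) := by
  -- The fresh letter x can be sent to r without disturbing p and q. The word m serves only to reach
  -- the threshold A; its image has letters in r and is absorbed by r at the end.
  obtain ⟨x, hx⟩ := Infinite.exists_notMem_finset (p.symbols ∪ q.symbols)
  obtain ⟨m, hm⟩ := exists_symbols_eq A
  obtain ⟨t, -, ht⟩ := h (.of x * m) (by rw [FreeMonoid.symbols_mul, hm]; simp)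
  set ψ : FreeMonoid α →* FreeMonoid α :=
    FreeMonoid.lift fun a => if a ∈ p.symbols ∪ q.symbols then φ (.of a) else r with hψ
  have hψof : ∀ a, ψ (.of a) = if a ∈ p.symbols ∪ q.symbols then φ (.of a) else r :=
    fun a => FreeMonoid.lift_eval_of _ _
  have hψx : ψ (.of x) = r := by rw [hψof, if_neg hx]
  have hψp : ψ p = φ p := hom_congr fun a ha => by
    rw [hψof, if_pos (Finset.mem_union_left _ ha)]
  have hψq : ψ q = φ q := hom_congr fun a ha => by
    rw [hψof, if_pos (Finset.mem_union_right _ ha)]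
  have hsub : ∀ w : FreeMonoid α, (ψ w).symbols ⊆ r.symbols := fun w =>
    symbols_hom_subset fun a _ => by
      rw [hψof]
      split_ifs with ha
      · rcases Finset.mem_union.1 ha with ha | ha
        · exact (subset_symbols_hom φ ha).trans hp
        · exact (subset_symbols_hom φ ha).trans hq
      · exact subset_rfl
  have key := W.subst ψ (fun a => by rw [hψof]; split_ifs <;> simp [hφ, hr]) ht
  simp only [map_mul, hψx, hψp, hψq] at key
  obtain ⟨s, hs, e, -⟩ := W.exists_rel_mul (hsub m)
  refine ⟨ψ m * ψ t * s, ?_, W.trans (W.mul_left (φ p) e) ?_⟩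
  · simp only [FreeMonoid.symbols_mul]
    exact Finset.union_subset (Finset.union_subset (hsub _) (hsub _)) hs
  · have := W.mul_right s key
    simpa only [mul_assoc] using this

/-- The word preorder which compares the left actions of words on the `R`-classes of words with
many letters. -/
def derived [Infinite α] (W : WordPreorder α K) : WordPreorder α K where
  rel p q := ∃ A : Finset α, ∀ r : FreeMonoid α, A ⊆ r.symbols →
    ∃ t : FreeMonoid α, t.symbols ⊆ r.symbols ∧ W.rel (p * r) (q * r * t)
  refl p := ⟨∅, fun r _ => ⟨1, by simp, by rw [mul_one]; exact W.refl _⟩⟩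
  trans := by
    rintro p q o ⟨A, hA⟩ ⟨B, hB⟩
    refine ⟨A ∪ B, fun r hr => ?_⟩
    obtain ⟨t, ht, e⟩ := hA r (Finset.union_subset_left hr)
    obtain ⟨t', ht', e'⟩ := hB r (Finset.union_subset_right hr)
    refine ⟨t' * t, ?_, W.trans e ?_⟩
    · rw [FreeMonoid.symbols_mul]
      exact Finset.union_subset ht' ht
    · simpa only [mul_assoc] using W.mul_right t e'
  mul_left := by
    rintro p q s ⟨A, hA⟩
    refine ⟨A, fun r hr => ?_⟩
    obtain ⟨t, ht, e⟩ := hA r hr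
    exact ⟨t, ht, by simpa only [mul_assoc] using W.mul_left s e⟩
  mul_right := by
    rintro p q s ⟨A, hA⟩
    refine ⟨A ∪ s.symbols, fun r hr => ?_⟩
    have hsr : (s * r).symbols = r.symbols := by
      rw [FreeMonoid.symbols_mul, Finset.union_eq_right.2 (Finset.union_subset_right hr)]
    obtain ⟨t, ht, e⟩ := hA (s * r) (by rw [hsr]; exact Finset.union_subset_left hr)
    exact ⟨t, hsr ▸ ht, by simpa only [mul_assoc] using e⟩
  subst := by
    rintro p q φ hφ ⟨A, hA⟩
    obtain ⟨z⟩ : Nonempty α := inferInstance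
    refine ⟨{z} ∪ (φ p).symbols ∪ (φ q).symbols, fun r hr => ?_⟩
    have hz : z ∈ r.symbols := hr (by simp)
    refine W.exists_rel_subst hA φ hφ ?_ ?_ (Finset.union_subset_right hr)
    · rintro rfl
      simp at hz
    · exact Finset.union_subset_right (Finset.union_subset_left hr)
  le_pow p := ⟨∅, fun r _ => ⟨1, by simp, by rw [mul_one]; exact W.mul_right _ (W.le_pow p)⟩⟩
  pow_le p := ⟨∅, fun r _ => ⟨1, by simp, by rw [mul_one]; exact W.mul_right _ (W.pow_le p)⟩⟩

/-- The identity substitution lowers the unknown threshold A of the derived preorder to the contents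
of p and q. -/
theorem exists_rel_of_derived [Infinite α] {W : WordPreorder α K} {p q r : FreeMonoid α}
    (h : W.derived.rel p q) (hr : r ≠ 1) (hp : p.symbols ⊆ r.symbols)
    (hq : q.symbols ⊆ r.symbols) :
    ∃ t : FreeMonoid α, t.symbols ⊆ r.symbols ∧ W.rel (p * r) (q * r * t) := by
  obtain ⟨A, hA⟩ := h
  exact W.exists_rel_subst hA (.id _) FreeMonoid.of_ne_one hr hp hq

end WordPreorder

end CompletelyRegular

namespace CompletelyRegular

/-! ### Rigidity: symmetry on words of equal content. -/

namespace WordPreorder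

variable {α : Type*} [DecidableEq α] {K : ℕ}

theorem symbols_pow_succ (w : FreeMonoid α) (k : ℕ) : (w ^ (k + 1)).symbols = w.symbols := by
  rw [pow_succ, FreeMonoid.symbols_mul, Finset.union_eq_right.2 (symbols_pow_subset w k)]

/-- Substitution for the letters following two prefixes which do not contain these letters. -/
theorem exists_rel_of_prefix (W : WordPreorder α K) {p q u v : FreeMonoid α} {x y : α}
    (h : W.rel (p * .of x * u) (q * .of y * v)) (hpq : p.symbols = q.symbols)
    (hx : x ∉ p.symbols) (hy : y ∉ p.symbols) {r s : FreeMonoid α} (hr : r ≠ 1) (hs : s ≠ 1)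
    (hxy : x = y → r = s) (hrs : r.symbols = s.symbols)
    (hu : (p * .of x * u).symbols ⊆ r.symbols) (hv : (q * .of y * v).symbols ⊆ r.symbols) :
    ∃ t : FreeMonoid α, t.symbols ⊆ r.symbols ∧ W.rel (p * r) (q * s * t) := by
  set ψ : FreeMonoid α →* FreeMonoid α :=
    FreeMonoid.lift fun a => if a = x then r else if a = y then s else .of a with hψ
  have hψof : ∀ a, ψ (.of a) = if a = x then r else if a = y then s else .of a :=
    fun a => FreeMonoid.lift_eval_of _ _
  have hfix : ∀ w : FreeMonoid α, w.symbols = p.symbols → ψ w = w := fun w hw =>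
    hom_congr (ψ := .id _) fun a ha => by
      rw [hw] at ha
      rw [hψof, if_neg (ne_of_mem_of_not_mem ha hx), if_neg (ne_of_mem_of_not_mem ha hy)]
      rfl
  have hψx : ψ (.of x) = r := by rw [hψof, if_pos rfl]
  have hψy : ψ (.of y) = s := by
    rw [hψof, if_pos rfl]
    split_ifs with hyx
    · exact hxy hyx.symm
    · rfl
  have hsub : ∀ w : FreeMonoid α, w.symbols ⊆ r.symbols → (ψ w).symbols ⊆ r.symbols := fun w hw =>
    symbols_hom_subset fun a ha => by
      rw [hψof]
      split_ifs
      · exact subset_rfl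
      · exact hrs.ge
      · simpa using hw ha
  have key := W.subst ψ (fun a => by rw [hψof]; split_ifs <;> simp [hr, hs]) h
  simp only [map_mul, hψx, hψy, hfix p rfl, hfix q hpq.symm] at key
  simp only [FreeMonoid.symbols_mul] at hu hv
  obtain ⟨t, ht, e, -⟩ := W.exists_rel_mul (hsub u (Finset.union_subset_right hu))
  refine ⟨ψ v * t, ?_, W.trans (W.mul_left p e) ?_⟩
  · rw [FreeMonoid.symbols_mul]
    exact Finset.union_subset (hsub v (Finset.union_subset_right hv)) ht
  · simpa only [mul_assoc] using W.mul_right t key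

/-- The induction hypothesis gives q r ≤ p r t for every r of full content. If x ≠ y, independent
substitutions for x and y allow the chain v = q r ≤ p r ⋯ ≤ q s ⋯ ≤ p s ⋯ = u ⋯. If x = y, then p x
and q x already have full content and absorb any further letters on the right. -/
theorem exists_le_mul [Infinite α] (W : WordPreorder α K) {u v : FreeMonoid α}
    (huv : u.symbols = v.symbols) (h : W.rel u v)
    (ih : ∀ p q : FreeMonoid α, p.symbols = q.symbols → p.symbols ⊂ u.symbols →
      W.derived.rel p q → W.derived.rel q p) :
    ∃ t : FreeMonoid α, t.symbols ⊆ u.symbols ∧ W.toQuot v ≤ W.toQuot u * W.toQuot t := by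
  by_cases hu1 : u = 1
  · subst hu1
    obtain rfl := symbols_eq_empty.1 huv.symm
    exact ⟨1, subset_rfl, by simp⟩
  have hA : u.symbols ≠ ∅ := fun h => hu1 (symbols_eq_empty.1 h)
  obtain ⟨p, q, x, y, u', v', hu, hv, hpq, hx, hy, hcase⟩ :=
    exists_common_prefix_symbols _ u.symbols 1 1 u v rfl hA.symm (by rw [one_mul])
      (by rw [one_mul, huv]) rfl
  rw [one_mul] at hu hv
  have hne : ∀ r : FreeMonoid α, u.symbols ⊆ r.symbols → r ≠ 1 := by
    rintro r hr rfl
    exact hA (Finset.subset_empty.1 hr)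
  have huA : p.symbols ∪ {x} ∪ u'.symbols = u.symbols := by
    rw [hu]
    simp only [FreeMonoid.symbols_mul, FreeMonoid.symbols_of]
  have hvA : q.symbols ∪ {y} ∪ v'.symbols = u.symbols := by
    rw [huv, hv]
    simp only [FreeMonoid.symbols_mul, FreeMonoid.symbols_of]
  have hpA : p.symbols ⊆ u.symbols := by rw [← huA]; grind
  have hpx : p.symbols ⊂ u.symbols :=
    Finset.ssubset_iff_of_subset hpA |>.2 ⟨x, by rw [← huA]; simp, hx⟩
  have hpqr : ∀ r s : FreeMonoid α, (x = y → r = s) → r.symbols = s.symbols →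
      u.symbols ⊆ r.symbols → ∃ t : FreeMonoid α, t.symbols ⊆ r.symbols ∧
        W.rel (p * r) (q * s * t) := fun r s hxy hrs hr =>
    W.exists_rel_of_prefix (hu ▸ hv ▸ h) hpq hx hy (hne r hr) (hne s (hrs ▸ hr)) hxy hrs
      (hu ▸ hr) (hv ▸ huv ▸ hr)
  have hqp : W.derived.rel q p :=
    ih p q hpq hpx ⟨u.symbols, fun r hr => hpqr r r (fun _ => rfl) rfl hr⟩
  have hqpr : ∀ r : FreeMonoid α, r.symbols = u.symbols → ∃ t : FreeMonoid α,
      t.symbols ⊆ u.symbols ∧ W.toQuot q * W.toQuot r ≤ W.toQuot p * W.toQuot r * W.toQuot t := by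
    intro r hr
    obtain ⟨t, ht, e⟩ := exists_rel_of_derived hqp (hne r hr.ge) (by rw [hr, ← hpq]; exact hpA)
      (by rw [hr]; exact hpA)
    exact ⟨t, hr ▸ ht, e⟩
  by_cases hxy : x = y
  swap
  -- The factor q ^ (K + 1) gives r full content while q r still has the value of v; similarly for
  -- s, p and u.
  · obtain ⟨r, hr⟩ : ∃ r, r = q ^ (K + 1) * .of y * v' := ⟨_, rfl⟩
    obtain ⟨s, hs⟩ : ∃ s, s = p ^ (K + 1) * .of x * u' := ⟨_, rfl⟩
    have hrA : r.symbols = u.symbols := by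
      simp only [hr, FreeMonoid.symbols_mul, symbols_pow_succ, FreeMonoid.symbols_of, hvA]
    have hsA : s.symbols = u.symbols := by
      simp only [hs, FreeMonoid.symbols_mul, symbols_pow_succ, FreeMonoid.symbols_of, huA]
    have hqr : W.toQuot q * W.toQuot r = W.toQuot v := by
      simp only [hr, hv, map_mul, map_pow, ← mul_assoc, mul_pow_self W.quot_pow]
    have hps : W.toQuot p * W.toQuot s = W.toQuot u := by
      simp only [hs, hu, map_mul, map_pow, ← mul_assoc, mul_pow_self W.quot_pow]
    obtain ⟨t₁, h₁, e₁⟩ := hqpr r hrA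
    obtain ⟨t₂, h₂, e₂⟩ := hpqr r s (fun e => absurd e hxy) (hrA.trans hsA.symm) hrA.ge
    obtain ⟨t₃, h₃, e₃⟩ := hqpr s hsA
    rw [← W.toQuot_le_toQuot] at e₂
    simp only [map_mul] at e₂
    refine ⟨t₃ * t₂ * t₁, ?_, ?_⟩
    · simp only [FreeMonoid.symbols_mul]
      exact Finset.union_subset (Finset.union_subset h₃ (hrA ▸ h₂)) h₁
    · calc W.toQuot v = W.toQuot q * W.toQuot r := hqr.symm
        _ ≤ W.toQuot p * W.toQuot r * W.toQuot t₁ := e₁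
        _ ≤ W.toQuot q * W.toQuot s * W.toQuot t₂ * W.toQuot t₁ := by gcongr
        _ ≤ W.toQuot p * W.toQuot s * W.toQuot t₃ * W.toQuot t₂ * W.toQuot t₁ := by gcongr
        _ = W.toQuot u * W.toQuot (t₃ * t₂ * t₁) := by
          rw [hps]
          simp only [map_mul, mul_assoc]
  · have hpxA := hcase.resolve_left (not_not.2 hxy)
    subst hxy
    have hqxA : (q * .of x).symbols = u.symbols := by
      rw [← hpxA, FreeMonoid.symbols_mul, FreeMonoid.symbols_mul, hpq]
    -- The test word x v has full content, and q x v t₂ = q x for some t₂, so v can be inserted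
    -- after q x before q is exchanged for p.
    obtain ⟨t₁, h₁, e₁⟩ := hqpr (.of x * v) (by
      rw [FreeMonoid.symbols_mul, FreeMonoid.symbols_of, ← huv, ← huA]; grind)
    obtain ⟨t₂, h₂, e₂⟩ := W.exists_toQuot_mul_eq (r := q * .of x) (s := v) (by rw [hqxA, huv])
    obtain ⟨t₃, h₃, e₃⟩ := W.exists_toQuot_mul_eq (r := p * .of x) (s := u')
      (by rw [hpxA, ← huA]; grind)
    refine ⟨t₃ * v * t₁ * t₂ * v', ?_, ?_⟩
    · simp only [FreeMonoid.symbols_mul, ← huv]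
      rw [hqxA] at h₂
      rw [hpxA] at h₃
      have : v'.symbols ⊆ u.symbols := by rw [← hvA]; grind
      grind
    · simp only [map_mul] at e₁ e₂ e₃ ⊢
      calc W.toQuot v = W.toQuot q * W.toQuot (.of x) * W.toQuot v' := by
            rw [hv, map_mul, map_mul]
        _ = W.toQuot q * (W.toQuot (.of x) * W.toQuot v) * W.toQuot t₂ * W.toQuot v' := by
          conv_lhs => rw [← e₂]
          simp only [mul_assoc]
        _ ≤ W.toQuot p * (W.toQuot (.of x) * W.toQuot v) * W.toQuot t₁ * W.toQuot t₂ *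
            W.toQuot v' := by gcongr
        _ = W.toQuot p * W.toQuot (.of x) * W.toQuot v * W.toQuot t₁ * W.toQuot t₂ *
            W.toQuot v' := by simp only [mul_assoc]
        _ = W.toQuot p * W.toQuot (.of x) * W.toQuot u' * W.toQuot t₃ * W.toQuot v *
            W.toQuot t₁ * W.toQuot t₂ * W.toQuot v' := by rw [e₃]
        _ = W.toQuot u * (W.toQuot t₃ * W.toQuot v * W.toQuot t₁ * W.toQuot t₂ *
            W.toQuot v') := by
          rw [hu]
          simp only [map_mul, mul_assoc]

theorem exists_eq_mul [Infinite α] (W : WordPreorder α K) {u v : FreeMonoid α}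
    (huv : u.symbols = v.symbols) (h : W.rel u v)
    (ih : ∀ p q : FreeMonoid α, p.symbols = q.symbols → p.symbols ⊂ u.symbols →
      W.derived.rel p q → W.derived.rel q p) :
    ∃ t : FreeMonoid α, t.symbols ⊆ u.symbols ∧ W.rel u (v * t) ∧ W.rel (v * t) u := by
  obtain ⟨b, hb, e⟩ := W.exists_le_mul huv h ih
  obtain ⟨t, -, ht⟩ := W.exists_toQuot_mul_eq (r := u) (s := b * u ^ (K + 1)) (by
    rw [FreeMonoid.symbols_mul, symbols_pow_succ]
    exact Finset.union_subset hb subset_rfl)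
  have key := eq_mul_of_le_mul (a := 1) (t := W.toQuot t) W.quot_pow
    (by rw [mul_one]; exact h : W.toQuot u ≤ W.toQuot v * 1) e
    (by rw [mul_one, ← map_pow, mul_assoc (W.toQuot u), ← map_mul]; exact ht)
  rw [one_mul, ← map_pow, ← map_mul] at key
  exact ⟨u ^ (K + 1), (symbols_pow_succ u K).le, key.le, key.ge⟩

/-- A word preorder is symmetric on words with the same letters. -/
theorem rel_symm [Infinite α] (W : WordPreorder α K) {u v : FreeMonoid α}
    (huv : u.symbols = v.symbols) (h : W.rel u v) : W.rel v u := by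
  -- The preorder must vary: the hypothesis is used for the derived preorders of both W and its
  -- reversal.
  induction hn : u.symbols.card using Nat.strong_induction_on generalizing W u v with
  | _ n ih =>
    have ih' : ∀ W' : WordPreorder α K, ∀ p q : FreeMonoid α, p.symbols = q.symbols →
        p.symbols ⊂ u.symbols → W'.rel p q → W'.rel q p := fun W' p q hpq hp hr =>
      ih _ (hn ▸ Finset.card_lt_card hp) W' hpq hr rfl
    obtain ⟨a, ha, e₁, e₂⟩ := W.exists_eq_mul huv h (ih' W.derived)
    obtain ⟨b, hb, f₁, f₂⟩ := W.reverse.exists_eq_mul (u := u.reverse) (v := v.reverse)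
      (by rw [symbols_reverse, symbols_reverse, huv])
      (by
        change W.rel _ _
        rwa [FreeMonoid.reverse_reverse, FreeMonoid.reverse_reverse])
      (by
        rw [symbols_reverse]
        exact ih' W.reverse.derived)
    change W.rel _ _ at f₁ f₂
    rw [FreeMonoid.reverse_mul, FreeMonoid.reverse_reverse, FreeMonoid.reverse_reverse] at f₁ f₂
    obtain ⟨t, -, ht⟩ := W.exists_toQuot_mul_eq (r := v) (s := a) (huv ▸ ha)
    have ea : W.toQuot u = W.toQuot v * W.toQuot a := le_antisymm e₁ e₂
    exact le_of_mul_eq (t := W.toQuot t) W.quot_pow (W.toQuot_le_toQuot.2 h) ea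
      (le_antisymm f₁ f₂ : W.toQuot u = W.toQuot b.reverse * W.toQuot v) (by rw [ea, ht])

end WordPreorder

end CompletelyRegular

/-! ### Uniform exponents and evaluation of words. -/

namespace CompletelyRegular

/-- A finite completely regular monoid satisfies an identity `x ^ (K + 2) = x`. -/
theorem exists_pow_eq_self {M : Type*} [Monoid M] [Finite M]
    (h : ∀ x : M, ∃ y, x * y * x = x ∧ x * y = y * x) : ∃ K : ℕ, ∀ x : M, x ^ (K + 2) = x := by
  obtain ⟨i, j, hij, e⟩ : ∃ i j : ℕ, i < j ∧ (fun x : M => x ^ i) = fun x => x ^ j := by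
    obtain ⟨i, j, hne, e⟩ := Finite.exists_ne_map_eq_of_infinite fun (k : ℕ) (x : M) => x ^ k
    rcases hne.lt_or_gt with h | h
    · exact ⟨i, j, h, e⟩
    · exact ⟨j, i, h, e.symm⟩
  -- Here K + 2 = (j - i) + 1, where j - i is a period of all powers; the inverse y cancels the
  -- preperiod i.
  refine ⟨j - i - 1, fun x => ?_⟩
  obtain ⟨y, h₁, h₂⟩ := h x
  have key : ∀ k, x ^ (k + 1) * y ^ k = x := by
    intro k
    induction k with
    | zero => simp
    | succ k ih =>
      calc x ^ (k + 1 + 1) * y ^ (k + 1) = x * (x ^ (k + 1) * y ^ k) * y := by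
            rw [pow_succ' x (k + 1), pow_succ y k]
            simp only [mul_assoc]
        _ = x := by rw [ih, mul_assoc, h₂, ← mul_assoc, h₁]
  calc x ^ (j - i - 1 + 2) = x ^ (j - i) * (x ^ (i + 1) * y ^ i) := by
        rw [key, ← pow_succ]
        congr 1
        omega
    _ = x ^ j * x * y ^ i := by
      rw [← mul_assoc, ← pow_add, ← pow_succ]
      congr 2
      omega
    _ = x := by rw [← congrFun e x, ← pow_succ, key]

section WithOne

variable {S : Type*}

/-- The order on `S` extended to `WithOne S` so that `1` is comparable only with itself. -/
def WithOneLE [LE S] (x y : WithOne S) : Prop :=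
  (x = 1 ∧ y = 1) ∨ ∃ a b : S, x = a ∧ y = b ∧ a ≤ b

theorem withOneLE_coe [LE S] {a b : S} : WithOneLE (a : WithOne S) b ↔ a ≤ b := by
  constructor
  · rintro (⟨h, -⟩ | ⟨c, d, hc, hd, h⟩)
    · exact absurd h WithOne.coe_ne_one
    · rwa [WithOne.coe_inj.1 hc, WithOne.coe_inj.1 hd]
  · exact fun h => .inr ⟨a, b, rfl, rfl, h⟩

theorem WithOneLE.refl [Preorder S] (x : WithOne S) : WithOneLE x x := by
  induction x using WithOne.recOneCoe with
  | one => exact .inl ⟨rfl, rfl⟩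
  | coe a => exact withOneLE_coe.2 le_rfl

theorem WithOneLE.trans [Preorder S] {x y z : WithOne S} (h : WithOneLE x y)
    (k : WithOneLE y z) : WithOneLE x z := by
  rcases h with ⟨rfl, rfl⟩ | ⟨a, b, rfl, rfl, h⟩
  · exact k
  · rcases k with ⟨k, -⟩ | ⟨c, d, hc, rfl, k⟩
    · exact absurd k WithOne.coe_ne_one
    · exact withOneLE_coe.2 (h.trans (WithOne.coe_inj.1 hc ▸ k))

theorem WithOneLE.mul_left [Semigroup S] [Preorder S] [MulLeftMono S] {x y : WithOne S}
    (z : WithOne S) (h : WithOneLE x y) : WithOneLE (z * x) (z * y) := by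
  induction z using WithOne.recOneCoe with
  | one => simpa only [one_mul] using h
  | coe c =>
    rcases h with ⟨rfl, rfl⟩ | ⟨a, b, rfl, rfl, h⟩
    · exact .refl _
    · simp only [← WithOne.coe_mul, withOneLE_coe]
      gcongr

theorem WithOneLE.mul_right [Semigroup S] [Preorder S] [MulRightMono S] {x y : WithOne S}
    (z : WithOne S) (h : WithOneLE x y) : WithOneLE (x * z) (y * z) := by
  induction z using WithOne.recOneCoe with
  | one => simpa only [mul_one] using h
  | coe c =>
    rcases h with ⟨rfl, rfl⟩ | ⟨a, b, rfl, rfl, h⟩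
    · exact .refl _
    · simp only [← WithOne.coe_mul, withOneLE_coe]
      gcongr

variable [Semigroup S] {α : Type*}

/-- The value of a word under an assignment of elements of a semigroup to the letters. -/
def eval (f : α → S) : FreeMonoid α →* WithOne S := FreeMonoid.lift fun a => (f a : WithOne S)

theorem eval_of (f : α → S) (a : α) : eval f (.of a) = f a := FreeMonoid.lift_eval_of _ _

theorem eval_ne_one (f : α → S) {w : FreeMonoid α} (hw : w ≠ 1) : eval f w ≠ 1 := by
  induction w using FreeMonoid.inductionOn' with
  | one => exact absurd rfl hw
  | of_mul a w ih =>
    rw [map_mul, eval_of]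
    cases eval f w using WithOne.recOneCoe with
    | one => simp
    | coe b => exact WithOne.coe_ne_one

theorem exists_eval_eq_coe (f : α → S) {w : FreeMonoid α} (hw : w ≠ 1) :
    ∃ s : S, eval f w = s :=
  (WithOne.ne_one_iff_exists.1 (eval_ne_one f hw)).imp fun _ h => h.symm

theorem eval_map {β : Type*} (f : β → S) (g : α → β) (w : FreeMonoid α) :
    eval f (FreeMonoid.map g w) = eval (f ∘ g) w := by
  induction w using FreeMonoid.inductionOn' with
  | one => simp
  | of_mul a w ih => rw [map_mul, map_mul, map_mul, ih, FreeMonoid.map_of, eval_of, eval_of]; rfl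

/-- Nonerasing is essential: the image of a letter must take a value in S, not the adjoined
identity. -/
theorem exists_eval_hom (f : α → S) (φ : FreeMonoid α →* FreeMonoid α)
    (hφ : ∀ a, φ (.of a) ≠ 1) : ∃ g : α → S, ∀ w, eval f (φ w) = eval g w := by
  choose g hg using fun a => exists_eval_eq_coe f (hφ a)
  refine ⟨g, fun w => ?_⟩
  induction w using FreeMonoid.inductionOn' with
  | one => simp
  | of_mul a w ih => rw [map_mul, map_mul, map_mul, ih, hg, eval_of]

/-- The inequalities between words which are valid in an ordered semigroup. -/
def inequalities (S : Type*) [Semigroup S] [PartialOrder S] [MulLeftMono S] [MulRightMono S]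
    {K : ℕ} (hK : ∀ x : WithOne S, x ^ (K + 2) = x) : WordPreorder ℕ K where
  rel p q := ∀ f : ℕ → S, WithOneLE (eval f p) (eval f q)
  refl p f := .refl _
  trans h k f := (h f).trans (k f)
  mul_left r h f := by
    rw [map_mul, map_mul]
    exact (h f).mul_left _
  mul_right r h f := by
    rw [map_mul, map_mul]
    exact (h f).mul_right _
  subst φ hφ h f := by
    obtain ⟨g, hg⟩ := exists_eval_hom f φ hφ
    rw [hg, hg]
    exact h g
  le_pow p f := by rw [map_pow, hK]; exact .refl _
  pow_le p f := by rw [map_pow, hK]; exact .refl _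

end WithOne

end CompletelyRegular

/-! ### From reversible inequalities to membership of the dual. -/

namespace FinOrdSemigroup

open CompletelyRegular

/-- A nonempty subsemigroup of a finite ordered semigroup, with the induced order. -/
def ofSubsemigroup (S : FinOrdSemigroup.{u}) (T : Subsemigroup S) (hT : Nonempty T) :
    FinOrdSemigroup.{u} where
  carrier := T
  mulLeftMono := ⟨fun a _ _ h => mul_le_mul_right (α := S) h a⟩
  mulRightMono := ⟨fun a _ _ h => mul_le_mul_left (α := S) h a⟩

theorem isSub_ofSubsemigroup (S : FinOrdSemigroup.{u}) (T : Subsemigroup S) (hT : Nonempty T) :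
    IsSub (S.ofSubsemigroup T hT) S :=
  ⟨MulMemClass.subtype T, Subtype.val_injective, fun _ _ => Iff.rfl⟩

theorem IsCompletelyRegular.exists_pow_eq_self {S : FinOrdSemigroup.{u}}
    (hS : S.IsCompletelyRegular) : ∃ K : ℕ, ∀ x : WithOne S, x ^ (K + 2) = x := by
  have : Finite (WithOne S) := inferInstanceAs (Finite (Option S))
  obtain ⟨inv, h⟩ := hS
  refine CompletelyRegular.exists_pow_eq_self fun x => ?_
  induction x using WithOne.recOneCoe with
  | one => exact ⟨1, by simp, rfl⟩
  | coe a =>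
    exact ⟨inv a, congrArg _ (h a).1, congrArg _ (h a).2.2⟩

end FinOrdSemigroup

namespace Pseudovariety

open FinOrdSemigroup CompletelyRegular

/-- If the inequalities valid in `S` which hold as equalities in `U` are reversible in `S`, then
the dual of `S` lies in every pseudovariety containing `S`, `U` and the dual of `U`. -/
theorem dual_mem_of_rel_symm (W : Pseudovariety.{u}) {S U : FinOrdSemigroup.{u}} (hS : S ∈ W)
    (hU : U ∈ W) (hU' : U.dual ∈ W)
    (h : ∀ p q : FreeMonoid ℕ, (∀ f : ℕ → S, WithOneLE (eval f p) (eval f q)) →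
      (∀ f : ℕ → U, eval f p = eval f q) → ∀ f : ℕ → S, WithOneLE (eval f q) (eval f p)) :
    S.dual ∈ W := by
  obtain ⟨k, ⟨e⟩⟩ := Finite.exists_equiv_fin S
  obtain ⟨l, ⟨e'⟩⟩ := Finite.exists_equiv_fin U
  -- One factor for each assignment of k = |S| letters in S, in U and in the dual of U.
  -- Comparability in the last two kinds of factors forces equality in U.
  let C : ((Fin k → Fin k) ⊕ (Fin k → Fin l) ⊕ (Fin k → Fin l)) → FinOrdSemigroup.{u}
    | .inl _ => S
    | .inr (.inl _) => U
    | .inr (.inr _) => U.dual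
  let a : ∀ i, Fin k → C i
    | .inl g => fun j => e.symm (g j)
    | .inr (.inl g) => fun j => e'.symm (g j)
    | .inr (.inr g) => fun j => OrderDual.toDual (e'.symm (g j))
  have hC : pi C ∈ W := W.pi_mem C fun
    | .inl _ => hS
    | .inr (.inl _) => hU
    | .inr (.inr _) => hU'
  let T : Subsemigroup (pi C) :=
    { carrier := {x | ∃ w : FreeMonoid (Fin k), ∀ i, eval (a i) w = (x i : C i)}
      mul_mem' := by
        rintro x y ⟨v, hv⟩ ⟨w, hw⟩
        refine ⟨v * w, fun i => ?_⟩
        rw [map_mul, hv, hw]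
        rfl }
  have hT : ∀ j : Fin k, (fun i => a i j : pi C) ∈ T := fun j => ⟨.of j, fun i => eval_of _ _⟩
  obtain ⟨s₀⟩ := S.nonempty
  have hTne : Nonempty T := ⟨⟨_, hT (e s₀)⟩⟩
  -- Projection to the coordinate of the tautological assignment is onto S. It is isotone into the
  -- dual because `h` reverses the inequality between representing words.
  refine W.image_mem (W.sub_mem hC (isSub_ofSubsemigroup _ T hTne))
    ⟨⟨fun x => OrderDual.toDual (x.1 (.inl id)), fun _ _ => rfl⟩, ?_, fun s => ?_⟩
  · rintro ⟨x, v, hv⟩ ⟨y, w, hw⟩ (hxy : ∀ i, x i ≤ y i)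
    obtain ⟨xS, hxS⟩ : ∃ z : (Fin k → Fin k) → S, z = fun g => x (.inl g) := ⟨_, rfl⟩
    obtain ⟨yS, hyS⟩ : ∃ z : (Fin k → Fin k) → S, z = fun g => y (.inl g) := ⟨_, rfl⟩
    have hvS : ∀ g : Fin k → Fin k, eval (fun j => e.symm (g j)) v = xS g :=
      fun g => by rw [hxS]; exact hv (.inl g)
    have hwS : ∀ g : Fin k → Fin k, eval (fun j => e.symm (g j)) w = yS g :=
      fun g => by rw [hyS]; exact hw (.inl g)
    have hleS : ∀ g, xS g ≤ yS g := fun g => by rw [hxS, hyS]; exact hxy (.inl g)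
    have hU₁ : ∀ g : Fin k → Fin l, ∃ x' y' : U, eval (fun j => e'.symm (g j)) v = x' ∧
        eval (fun j => e'.symm (g j)) w = y' ∧ x' ≤ y' := fun g =>
      ⟨x (.inr (.inl g)), y (.inr (.inl g)), hv (.inr (.inl g)), hw (.inr (.inl g)), hxy _⟩
    have hU₂ : ∀ g : Fin k → Fin l, ∃ x' y' : U, eval (fun j => e'.symm (g j)) v = x' ∧
        eval (fun j => e'.symm (g j)) w = y' ∧ y' ≤ x' := fun g =>
      ⟨x (.inr (.inr g)), y (.inr (.inr g)), hv (.inr (.inr g)), hw (.inr (.inr g)),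
        hxy (.inr (.inr g))⟩
    have key := h (FreeMonoid.map Fin.val v) (FreeMonoid.map Fin.val w) (fun f => by
        have hf : f ∘ Fin.val = fun j : Fin k => e.symm (e (f j)) :=
          funext fun j => (e.symm_apply_apply _).symm
        rw [eval_map, eval_map, hf, hvS fun j => e (f j), hwS fun j => e (f j)]
        exact withOneLE_coe.2 (hleS _))
      (fun f => by
        have hf : f ∘ Fin.val = fun j : Fin k => e'.symm (e' (f j)) :=
          funext fun j => (e'.symm_apply_apply _).symm
        rw [eval_map, eval_map, hf]
        obtain ⟨x₁, y₁, hx₁, hy₁, h₁⟩ := hU₁ fun j => e' (f j)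
        obtain ⟨x₂, y₂, hx₂, hy₂, h₂⟩ := hU₂ fun j => e' (f j)
        obtain rfl := WithOne.coe_inj.1 (hx₁.symm.trans hx₂)
        obtain rfl := WithOne.coe_inj.1 (hy₁.symm.trans hy₂)
        rw [hx₁, hy₁, le_antisymm h₁ h₂])
      -- The words use only letters below k, so the value s₀ elsewhere is irrelevant.
      fun n => if hn : n < k then e.symm ⟨n, hn⟩ else s₀
    have hf : (fun n => if hn : n < k then e.symm ⟨n, hn⟩ else s₀) ∘ Fin.val =
        fun j : Fin k => e.symm (id j) := funext fun j => dif_pos j.2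
    rw [eval_map, eval_map, hf, hvS, hwS, withOneLE_coe, hxS, hyS] at key
    exact key
  · refine ⟨⟨_, hT (e (OrderDual.ofDual s))⟩, ?_⟩
    exact congrArg OrderDual.toDual (e.symm_apply_apply (OrderDual.ofDual s))

end Pseudovariety

/-! ### Comparable idempotents. -/

namespace CompletelyRegular

section Semilattice

variable {U : Type*} [Semigroup U] {e f : U} {α : Type*} [DecidableEq α] {x : α}

theorem eval_ite_of_notMem (hee : e * e = e) {w : FreeMonoid α} (hx : x ∉ w.symbols) :
    eval (fun a => if a = x then f else e) w = 1 ∨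
      eval (fun a => if a = x then f else e) w = e := by
  induction w using FreeMonoid.inductionOn' with
  | one => exact .inl (map_one _)
  | of_mul a w ih =>
    simp only [FreeMonoid.symbols_mul, FreeMonoid.symbols_of, Finset.mem_union,
      Finset.mem_singleton, not_or] at hx
    rw [map_mul, eval_of, if_neg (Ne.symm hx.1)]
    rcases ih hx.2 with h | h <;> rw [h]
    · exact .inr (mul_one _)
    · exact .inr (congrArg _ hee)

theorem eval_ite_of_mem (hee : e * e = e) (hff : f * f = f) (hef : e * f = f) (hfe : f * e = f)
    {w : FreeMonoid α} (hx : x ∈ w.symbols) :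
    eval (fun a => if a = x then f else e) w = f := by
  induction w using FreeMonoid.inductionOn' with
  | one => simp at hx
  | of_mul a w ih =>
    rw [map_mul, eval_of]
    by_cases hw : x ∈ w.symbols
    · rw [ih hw, ← WithOne.coe_mul]
      split_ifs
      · rw [hff]
      · rw [hef]
    · simp only [FreeMonoid.symbols_mul, FreeMonoid.symbols_of, Finset.mem_union,
        Finset.mem_singleton, hw, or_false] at hx
      rw [if_pos hx.symm]
      rcases eval_ite_of_notMem (f := f) hee hw with h | h <;> rw [h]
      · exact mul_one _
      · exact congrArg _ hfe

/-- Sending x to f and all other letters to e gives the value f exactly on the words containing x.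
-/
theorem mem_symbols_of_eval_eq (hee : e * e = e) (hff : f * f = f) (hef : e * f = f)
    (hfe : f * e = f) (hne : e ≠ f) {p q : FreeMonoid α}
    (h : eval (fun a => if a = x then f else e) p = eval (fun a => if a = x then f else e) q)
    (hx : x ∈ p.symbols) : x ∈ q.symbols := by
  by_contra hxq
  rw [eval_ite_of_mem hee hff hef hfe hx] at h
  rcases eval_ite_of_notMem (f := f) hee hxq with h' | h' <;> rw [h'] at h
  · exact WithOne.coe_ne_one h
  · exact hne (WithOne.coe_inj.1 h.symm)

end Semilattice

/-- In a completely regular semigroup in which comparable idempotents are equal, every element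
absorbs every other one. -/
theorem pow_mul_eq_self {S : Type*} [Semigroup S] {K : ℕ}
    (hK : ∀ x : WithOne S, x ^ (K + 2) = x)
    (h : ∀ e f : S, e * e = e → f * f = f → e * f = f → f * e = f → e = f) (a b : S) :
    ((a : WithOne S) * b * a) ^ (K + 1) * a = a := by
  have coe : ∀ c : S, ∃ d : S, (c : WithOne S) ^ (K + 1) = d := fun c => by
    have := exists_eval_eq_coe (fun _ : Unit => c) (w := FreeMonoid.of () ^ (K + 1)) (by
      rw [pow_succ]
      intro h
      simpa [FreeMonoid.length_mul] using congrArg FreeMonoid.length h)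
    simpa only [map_pow, eval_of] using this
  -- The idempotent powers e of a and f of aba satisfy ef = fe = f, since aba begins and ends with
  -- a; hence they coincide.
  obtain ⟨e, he⟩ := coe a
  obtain ⟨f, hf⟩ := coe (a * b * a)
  rw [WithOne.coe_mul, WithOne.coe_mul] at hf
  have hea : (e : WithOne S) * a = a := by rw [← he, pow_mul_self hK]
  have hae : (a : WithOne S) * e = a := by rw [← he, mul_pow_self hK]
  have hef : e = f := by
    refine h e f ?_ ?_ ?_ ?_ <;> rw [← WithOne.coe_inj, WithOne.coe_mul]
    · rw [← he, pow_mul_pow hK]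
    · rw [← hf, pow_mul_pow hK]
    · rw [← hf, pow_succ']
      simp only [← mul_assoc, hea]
    · rw [← hf, pow_succ]
      simp only [mul_assoc, hae]
  rw [hf, ← hef, hea]

end CompletelyRegular

/-! ### The dichotomy and the conclusion. -/

namespace Pseudovariety

open FinOrdSemigroup CompletelyRegular

theorem dual_mem_sup_selfdualClosure (V : Pseudovariety.{u})
    (hV : ∀ S : FinOrdSemigroup.{u}, S ∈ V → S.IsCompletelyRegular) {S : FinOrdSemigroup.{u}}
    (hS : S ∈ V) : S.dual ∈ V ⊔ (V ⊓ semilattices).selfdualClosure := by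
  obtain ⟨W, hW⟩ : ∃ W, W = V ⊔ (V ⊓ semilattices).selfdualClosure := ⟨_, rfl⟩
  have hVW : V ≤ W := hW ▸ le_sup_left
  have hVW' : (V ⊓ semilattices).dual ≤ W :=
    hW ▸ (le_sup_right : _ ≤ (V ⊓ semilattices).selfdualClosure).trans le_sup_right
  rw [← hW]
  obtain ⟨K, hK⟩ := (hV S hS).exists_pow_eq_self
  by_cases h : ∃ T : FinOrdSemigroup.{u}, T ∈ V ∧
      ∃ e f : T, e * e = e ∧ f * f = f ∧ e * f = f ∧ f * e = f ∧ e ≠ f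
  · obtain ⟨T, hT, e, f, hee, hff, hef, hfe, hne⟩ := h
    let P : Subsemigroup T :=
      { carrier := {e, f}
        mul_mem' := by rintro a b (rfl | rfl) (rfl | rfl) <;> simp_all }
    have hU : T.ofSubsemigroup P ⟨⟨e, .inl rfl⟩⟩ ∈ V :=
      V.sub_mem hT (isSub_ofSubsemigroup _ P _)
    have hU' : (T.ofSubsemigroup P ⟨⟨e, .inl rfl⟩⟩).IsSemilattice := by
      constructor
      · rintro ⟨a, rfl | rfl⟩
        · exact Subtype.ext hee
        · exact Subtype.ext hff
      · rintro ⟨a, rfl | rfl⟩ ⟨b, rfl | rfl⟩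
        · rfl
        · exact Subtype.ext (hef.trans hfe.symm)
        · exact Subtype.ext (hfe.trans hef.symm)
        · rfl
    refine W.dual_mem_of_rel_symm (hVW hS) (hVW hU) (hVW' (a := FinOrdSemigroup.dual _) ⟨hU, hU'⟩)
      fun p q hpq he => (inequalities S hK).rel_symm ?_ hpq
    ext x
    have key : ∀ {p q : FreeMonoid ℕ}, (∀ g : ℕ → P, eval g p = eval g q) →
        x ∈ p.symbols → x ∈ q.symbols := fun h =>
      mem_symbols_of_eval_eq (e := (⟨e, .inl rfl⟩ : P)) (f := ⟨f, .inr rfl⟩) (Subtype.ext hee)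
        (Subtype.ext hff) (Subtype.ext hef) (Subtype.ext hfe)
        (fun h => hne (congrArg Subtype.val h)) (h _)
    exact ⟨key he, key fun g => (he g).symm⟩
  · push Not at h
    -- The empty product is trivial and lies in every pseudovariety, so it can serve as U and
    -- imposes no comparison of contents.
    have hU : ∀ X : Pseudovariety.{u}, pi (fun i : Empty => i.elim) ∈ X :=
      fun X => X.pi_mem _ fun i => i.elim
    refine W.dual_mem_of_rel_symm (hVW hS) (hU W) (hU W.dual) fun p q hpq _ f => ?_
    have habs := pow_mul_eq_self hK (h S hS)
    -- The adjoined identity is comparable only with itself, so the empty word is comparable only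
    -- with itself.
    have one_iff : p = 1 ↔ q = 1 := by
      obtain ⟨s⟩ := S.nonempty
      have hs := hpq fun _ => s
      constructor <;> rintro rfl <;> by_contra hne <;>
        obtain ⟨t, ht⟩ := exists_eval_eq_coe (fun _ => s) hne <;>
        rw [ht, map_one] at hs <;>
        rcases hs with ⟨h₁, h₂⟩ | ⟨a, b, h₁, h₂, -⟩ <;> simp_all
    by_cases hp : p = 1
    · rw [one_iff.1 hp, hp]
      exact .refl _
    have hq : q ≠ 1 := fun h => hp (one_iff.2 h)
    have hsat : ∀ {u v : FreeMonoid ℕ}, u ≠ 1 → v ≠ 1 → ∀ g : ℕ → S,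
        eval g ((u * v * u) ^ (K + 1) * u) = eval g u := by
      intro u v hu hv g
      obtain ⟨a, ha⟩ := exists_eval_eq_coe g hu
      obtain ⟨b, hb⟩ := exists_eval_eq_coe g hv
      simp only [map_mul, map_pow, ha, hb, habs]
    -- Both words have the letters of p and q together, and by `hsat` the same values in S as p and
    -- q.
    have key := (inequalities S hK).rel_symm (u := (p * q * p) ^ (K + 1) * p)
      (v := (q * p * q) ^ (K + 1) * q) (by
        simp only [FreeMonoid.symbols_mul, WordPreorder.symbols_pow_succ]
        grind) (fun g => by
        rw [hsat hp hq, hsat hq hp]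
        exact hpq g) f
    rwa [hsat hp hq, hsat hq hp] at key

end Pseudovariety

theorem propositionp (V : Pseudovariety.{u})
    (hV : ∀ S : FinOrdSemigroup.{u}, S ∈ V → S.IsCompletelyRegular) :
    V.selfdualClosure = V ⊔ (V ⊓ Pseudovariety.semilattices).selfdualClosure := by
  apply le_antisymm
  · exact sup_le le_sup_left fun S hS =>
      Pseudovariety.dual_mem_sup_selfdualClosure V hV (S := S.dual) hS
  · exact sup_le le_sup_left (sup_le (inf_le_left.trans le_sup_left)
      ((Pseudovariety.dual_mono inf_le_left).trans le_sup_right))
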